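/- Let $X$ be a (real or complex) Banach space and let $(A(t),D(A(t)))_{t\in\mathbb R}$, $(B(t),D(B(t)))_{t\in\mathbb R}$ be families of linear operators in $X$; $A(t)+B(t)$ has domain $D(A(t))\cap D(B(t))$. For such a family $A(\cdot)$, a classical solution of $(\mathrm{NCP})_{s,y}$ is a function $u\in C^1([s,\infty);X)$ with $u(t)\in D(A(t))$ and $u'(t)=A(t)u(t)$ for $t\ge s$, and $u(s)=y$; let $Y_s$ be the set of all $y$ for which one exists. The non-autonomous Cauchy problem for $A(\cdot)$ is called *well-posed* if (i) $Y_s$ is dense in $X$ for every $s\in\mathbb R$; (ii) the solution $u_s(\cdot,y)$ is unique for every $y\in Y_s$; (iii) whenever $s_n\to s$ and $Y_{s_n}\ni y_n\to y\in Y_s$, then $\hat u_{s_n}(t,y_n)\to\hat u_s(t,y)$ uniformly for $t$ in compact subsets of $\mathbb R$, where $\hat u_r(t,y)=u_r(t,y)$ for $t\ge r$ and $\hat u_r(t,y)=y$ for $t<r$; (iv) there are $M\ge1$, $\omega\in\mathbb R$ with $\|u_s(t,y)\|\le Me^{\omega(t-s)}\|y\|$ for all $s\le t$ and $y\in Y_s$.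 An *evolution family* is a family $(U(t,s))_{t\ge s}$ of bounded linear operators on $X$ with $U(t,r)U(r,s)=U(t,s)$ for $t\ge r\ge s$ and $U(t,t)=I$, such that $(t,s)\mapsto U(t,s)$ is strongly continuous and $\|U(t,s)\|\le Me^{\omega(t-s)}$ for all $t\ge s$, for some $M\ge1$, $\omega\in\mathbb R$. It *solves* the problem for $A(\cdot)$ if for every $s$ the set of those $y\in X$ for which $t\mapsto U(t,s)y$ is a classical solution of $(\mathrm{NCP})_{s,y}$ is dense in $X$. Its *evolution semigroup* on $C_0(\mathbb R;X)$ is $(\mathcal T(t)f)(s)=U(s,s-t)f(s-t)$, $t\ge0$. On $C_0(\mathbb R;X)$ let $\frac{d}{ds}$ have the domain $\{f\in C^1(\mathbb R;X): f,f'\in C_0(\mathbb R;X)\}$, let $(A(\cdot)f)(s)=A(s)f(s)$ have the domain of all $f\in C_0(\mathbb R;X)$ with $f(s)\in D(A(s))$ for all $s$ and $A(\cdot)f(\cdot)\in C_0(\mathbb R;X)$, and likewise for $B(\cdot)$; sums of operators have the intersection of the domains as domain. **Theorem.** Assume that (a) the non-autonomous Cauchy problems for $A(\cdot)+B(\cdot)$,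 $A(\cdot)$ and $B(\cdot)$ are well-posed, with solving evolution families $W$, $U$, $V$ respectively, and the evolution semigroups of $W$, $U$, $V$ on $C_0(\mathbb R;X)$ are generated by the closures of $-\frac{d}{ds}+A(\cdot)+B(\cdot)$, $-\frac{d}{ds}+A(\cdot)$ and $-\frac{d}{ds}+B(\cdot)$, respectively; (b) (stability) there are $M\ge1$ and $\omega\in\mathbb R$ such that for all $t\ge0$ and all integers $n\ge1$ $$\sup_{s\in\mathbb R}\Bigl\|\prod_{p=n-1}^{0}V\bigl(s-\tfrac{pt}{n},s-\tfrac{(p+1)t}{n}\bigr)\,U\bigl(s-\tfrac{pt}{n},s-\tfrac{(p+1)t}{n}\bigr)\Bigr\|\le Me^{\omega t}.$$ Then for all $s\le t$ and all $x\in X$, in the norm of $X$, $$W(t,s)x=\lim_{n\to\infty}\prod_{p=0}^{n-1}V\bigl(s+\tfrac{(p+1)(t-s)}{n},s+\tfrac{p(t-s)}{n}\bigr)\,U\bigl(s+\tfrac{(p+1)(t-s)}{n},s+\tfrac{p(t-s)}{n}\bigr)x .$$ Here $\prod_{p=0}^{n-1}F_p=F_{n-1}\cdots F_1F_0$ and $\prod_{p=n-1}^{0}F_p=F_0F_1\cdots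 F_{n-1}$. -/

import Mathlib

open Set Filter Topology
open scoped NNReal ZeroAtInfty

namespace NonautonomousSplitting

section Cauchy

variable {𝕜 X : Type*} [RCLike 𝕜] [NormedAddCommGroup X] [NormedSpace 𝕜 X] [NormedSpace ℝ X]

/-- `u` (looked at on `[s, ∞)`) is a classical solution of `u' = A(t) u`, `u(s) = y`: it is `C¹` on
`[s, ∞)` (one-sided derivative at `s`), takes values in the domains, and satisfies the equation. -/
structure IsClassicalSolution (A : ℝ → X →ₗ.[𝕜] X) (s : ℝ) (y : X) (u : ℝ → X) : Prop where
  contDiffOn : ContDiffOn ℝ 1 u (Ici s)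
  initial : u s = y
  equation : ∀ t, s ≤ t → ∃ h : u t ∈ (A t).domain, derivWithin u (Ici s) t = A t ⟨u t, h⟩

/-- The regularity subspace `Y_s`: the initial values at time `s` that have a classical solution. -/
def regularitySet (A : ℝ → X →ₗ.[𝕜] X) (s : ℝ) : Set X :=
  {y | ∃ u, IsClassicalSolution A s y u}

/-- The extension `û_s(·, y)` of a solution on `[s, ∞)` to all times, constant `y` before `s`. -/
noncomputable def extendSolution (s : ℝ) (y : X) (u : ℝ → X) : ℝ → X :=
  fun t => if s ≤ t then u t else y

/-- Well-posedness of the non-autonomous Cauchy problem for `A` (with exponentially bounded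
solutions): existence for densely many initial values, uniqueness, continuous dependence on the
initial time and the initial value, exponential boundedness. -/
structure WellPosed (A : ℝ → X →ₗ.[𝕜] X) : Prop where
  existence : ∀ s, Dense (regularitySet A s)
  uniqueness : ∀ s y u v, IsClassicalSolution A s y u → IsClassicalSolution A s y v →
    ∀ t, s ≤ t → u t = v t
  continuousDependence : ∀ (s : ℝ) (y : X) (u : ℝ → X) (σ : ℕ → ℝ) (η : ℕ → X) (v : ℕ → ℝ → X),
    IsClassicalSolution A s y u → (∀ n, IsClassicalSolution A (σ n) (η n) (v n)) →
    Tendsto σ atTop (𝓝 s) → Tendsto η atTop (𝓝 y) →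
    ∀ K : Set ℝ, IsCompact K →
      TendstoUniformlyOn (fun n => extendSolution (σ n) (η n) (v n)) (extendSolution s y u) atTop K
  expBounded : ∃ M ω : ℝ, 1 ≤ M ∧ ∀ s y u, IsClassicalSolution A s y u →
    ∀ t, s ≤ t → ‖u t‖ ≤ M * Real.exp (ω * (t - s)) * ‖y‖

end Cauchy

section Family

variable {𝕜 X : Type*} [RCLike 𝕜] [NormedAddCommGroup X] [NormedSpace 𝕜 X]

/-- An exponentially bounded evolution family `(U(t,s))_{t ≥ s}`; the values `U t s` with `t < s`
play no role. -/
structure IsEvolutionFamily (U : ℝ → ℝ → X →L[𝕜] X) : Prop where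
  comp : ∀ t r s, s ≤ r → r ≤ t → U t r ∘L U r s = U t s
  diag : ∀ t, U t t = ContinuousLinearMap.id 𝕜 X
  strongCont : ∀ x, ContinuousOn (fun p : ℝ × ℝ => U p.1 p.2 x) {p | p.2 ≤ p.1}
  expBounded : ∃ M ω : ℝ, 1 ≤ M ∧ ∀ t s, s ≤ t → ‖U t s‖ ≤ M * Real.exp (ω * (t - s))

/-- The evolution family `U` solves the non-autonomous Cauchy problem for `A`: for every `s` the
orbit `t ↦ U(t,s) y` is a classical solution for all `y` in a dense set. -/
structure IsSolvingFamily [NormedSpace ℝ X] (A : ℝ → X →ₗ.[𝕜] X) (U : ℝ → ℝ → X →L[𝕜] X) :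
    Prop extends IsEvolutionFamily U where
  solves : ∀ s, Dense {y | IsClassicalSolution A s y (fun t => U t s y)}

/-- `∏_{p=0}^{n-1} F p = F (n-1) ⋯ F 1 F 0`. -/
def timeOrderedProd (F : ℕ → X →L[𝕜] X) (n : ℕ) : X →L[𝕜] X :=
  (((List.range n).map F).reverse).prod

/-- `∏_{p=n-1}^{0} F p = F 0 F 1 ⋯ F (n-1)`. -/
def reverseTimeOrderedProd (F : ℕ → X →L[𝕜] X) (n : ℕ) : X →L[𝕜] X :=
  ((List.range n).map F).prod

/-- The function `s ↦ U(s, s - t) f(s - t)` is continuous. -/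
theorem IsEvolutionFamily.continuous_evolve {U : ℝ → ℝ → X →L[𝕜] X} (hU : IsEvolutionFamily U)
    (t : ℝ≥0) (f : C₀(ℝ, X)) : Continuous fun s : ℝ => U s (s - t) (f (s - t)) := by
  obtain ⟨M, ω, -, hM⟩ := hU.expBounded
  have ht : (0 : ℝ) ≤ t := t.2
  rw [continuous_iff_continuousAt]
  intro s₀
  have h1 : Tendsto (fun s : ℝ => U s (s - t) (f (s₀ - t))) (𝓝 s₀)
      (𝓝 (U s₀ (s₀ - t) (f (s₀ - t)))) := by
    have hc : Continuous fun s : ℝ => U s (s - t) (f (s₀ - t)) := by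
      refine (hU.strongCont (f (s₀ - t))).comp_continuous (f := fun s : ℝ => (s, s - (t : ℝ)))
        (by fun_prop) ?_
      intro s
      simp
    exact hc.tendsto s₀
  have h2 : Tendsto (fun s : ℝ => U s (s - t) (f (s - t) - f (s₀ - t))) (𝓝 s₀) (𝓝 0) := by
    have hf : Tendsto (fun s : ℝ => M * Real.exp (ω * t) * ‖f (s - t) - f (s₀ - t)‖) (𝓝 s₀)
        (𝓝 0) := by
      have hc : Continuous fun s : ℝ => M * Real.exp (ω * t) * ‖f (s - t) - f (s₀ - t)‖ := by
        fun_prop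
      simpa using hc.tendsto s₀
    refine squeeze_zero_norm (fun s => ?_) hf
    refine (ContinuousLinearMap.le_opNorm _ _).trans ?_
    have := hM s (s - t) (by linarith)
    rw [sub_sub_cancel] at this
    gcongr
  have h3 := h1.add h2
  rw [add_zero] at h3
  refine h3.congr fun s => ?_
  rw [← map_add]
  congr 1
  abel

/-- The function `s ↦ U(s, s - t) f(s - t)` vanishes at infinity. -/
theorem IsEvolutionFamily.zero_at_infty_evolve {U : ℝ → ℝ → X →L[𝕜] X}
    (hU : IsEvolutionFamily U) (t : ℝ≥0) (f : C₀(ℝ, X)) :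
    Tendsto (fun s : ℝ => U s (s - t) (f (s - t))) (cocompact ℝ) (𝓝 0) := by
  obtain ⟨M, ω, -, hM⟩ := hU.expBounded
  have ht : (0 : ℝ) ≤ t := t.2
  have h1 : Tendsto (fun s : ℝ => f (s - t)) (cocompact ℝ) (𝓝 0) :=
    f.zero_at_infty'.comp (Homeomorph.subRight (t : ℝ)).isClosedEmbedding.tendsto_cocompact
  have h2 : Tendsto (fun s : ℝ => M * Real.exp (ω * t) * ‖f (s - t)‖) (cocompact ℝ) (𝓝 0) := by
    simpa using (h1.norm.const_mul (M * Real.exp (ω * t)))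
  refine squeeze_zero_norm (fun s => ?_) h2
  refine (ContinuousLinearMap.le_opNorm _ _).trans ?_
  have := hM s (s - t) (by linarith)
  rw [sub_sub_cancel] at this
  gcongr

/-- The evolution semigroup `(𝒯(t) f)(s) = U(s, s - t) f(s - t)` on `C₀(ℝ, X)`. -/
def evolutionSemigroup {U : ℝ → ℝ → X →L[𝕜] X} (hU : IsEvolutionFamily U) (t : ℝ≥0)
    (f : C₀(ℝ, X)) : C₀(ℝ, X) where
  toFun s := U s (s - t) (f (s - t))
  continuous_toFun := hU.continuous_evolve t f
  zero_at_infty' := hU.zero_at_infty_evolve t f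

end Family

section Generator

variable {𝕜 X : Type*} [RCLike 𝕜] [NormedAddCommGroup X] [NormedSpace 𝕜 X] [NormedSpace ℝ X]

/-- The graph of the infinitesimal generator of the evolution semigroup of `U` on `C₀(ℝ, X)`:
`(f, g)` belongs to it iff `(𝒯(h) f - f) / h → g` in the norm of `C₀(ℝ, X)` as `h ↓ 0`. -/
def evolutionGeneratorGraph {U : ℝ → ℝ → X →L[𝕜] X} (hU : IsEvolutionFamily U) :
    Set (C₀(ℝ, X) × C₀(ℝ, X)) :=
  {p | Tendsto (fun h : ℝ≥0 => (h : ℝ)⁻¹ • (evolutionSemigroup hU h p.1 - p.1)) (𝓝[>] 0) (𝓝 p.2)}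

/-- The graph of `d/ds` on `C₀(ℝ, X)`, with domain `{f ∈ C¹(ℝ, X) : f, f' ∈ C₀(ℝ, X)}`. -/
def derivGraph (X : Type*) [NormedAddCommGroup X] [NormedSpace ℝ X] :
    Set (C₀(ℝ, X) × C₀(ℝ, X)) :=
  {p | ∀ s, HasDerivAt p.1 (p.2 s) s}

/-- The graph of the multiplication operator `(A(·) f)(s) = A(s) f(s)` on `C₀(ℝ, X)`, with domain
`{f : f(s) ∈ D(A(s)) for all s, and s ↦ A(s) f(s) lies in C₀(ℝ, X)}`. -/
def multiplicationGraph (A : ℝ → X →ₗ.[𝕜] X) : Set (C₀(ℝ, X) × C₀(ℝ, X)) :=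
  {p | ∀ s, ∃ h : p.1 s ∈ (A s).domain, A s ⟨p.1 s, h⟩ = p.2 s}

/-- The graph of `-d/ds + A(·)` on `C₀(ℝ, X)` (domain: the intersection of the two domains). -/
def negDerivAddGraph (A : ℝ → X →ₗ.[𝕜] X) : Set (C₀(ℝ, X) × C₀(ℝ, X)) :=
  {p | ∃ f' a, (p.1, f') ∈ derivGraph X ∧ (p.1, a) ∈ multiplicationGraph A ∧ p.2 = -f' + a}

/-- The graph of `-d/ds + A(·) + B(·)` on `C₀(ℝ, X)` (domain: the intersection of the three
domains). -/
def negDerivAddAddGraph (A B : ℝ → X →ₗ.[𝕜] X) : Set (C₀(ℝ, X) × C₀(ℝ, X)) :=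
  {p | ∃ f' a b, (p.1, f') ∈ derivGraph X ∧ (p.1, a) ∈ multiplicationGraph A ∧
    (p.1, b) ∈ multiplicationGraph B ∧ p.2 = -f' + a + b}

/-- The closure of the operator on `C₀(ℝ, X)` with graph `C` generates the evolution semigroup of
`U`: the closure of the graph `C` is the graph of the generator. -/
def ClosureGenerates (C : Set (C₀(ℝ, X) × C₀(ℝ, X))) {U : ℝ → ℝ → X →L[𝕜] X}
    (hU : IsEvolutionFamily U) : Prop :=
  closure C = evolutionGeneratorGraph hU

end Generator

/-- Stability: there are `M ≥ 1` and `ω` such that for all `t ≥ 0`, all `n ≥ 1` and all `s`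
`‖∏_{p=n-1}^{0} V(s - pt/n, s - (p+1)t/n) U(s - pt/n, s - (p+1)t/n)‖ ≤ M e^{ωt}`. -/
def SplittingStable {𝕜 X : Type*} [RCLike 𝕜] [NormedAddCommGroup X] [NormedSpace 𝕜 X]
    (U V : ℝ → ℝ → X →L[𝕜] X) : Prop :=
  ∃ M ω : ℝ, 1 ≤ M ∧ ∀ t : ℝ, 0 ≤ t → ∀ n : ℕ, 1 ≤ n → ∀ s : ℝ,
    ‖reverseTimeOrderedProd (fun p => V (s - p * t / n) (s - (p + 1) * t / n) ∘L
      U (s - p * t / n) (s - (p + 1) * t / n)) n‖ ≤ M * Real.exp (ω * t)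

end NonautonomousSplitting

/-! Pass to the autonomous evolution semigroups on `C₀(ℝ, X)` and apply Chernoff's product formula
there. The composition of the evolution operators of `V` and `U` over a step `h` shifts the argument
by `2h`; inserting the translation by `+h` between them leaves a shift by `h`, and this is one
splitting step `F(h)` (`splittingOperator`). Translation by `+h` has generator `d/ds`, so the
derivative of `F` at `0` is formally `(-d/ds + A) + d/ds + (-d/ds + B) = -d/ds + A + B`, whose
closure generates the evolution semigroup of `W`. The value of `F(h)^n f` at `t` is the splitting
product applied to `f(t - nh)`; with `h = (t - s)/n` and `f(s) = x` this is the assertion. The same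
identity turns the stability assumption into a bound for `F(h)^n`.

The limit semigroup `S` is given, so Chernoff's formula
(`IsStronglyContinuousSemigroup.tendsto_pow_div`) needs no resolvents. An orbit `τ ↦ S(τ) f` with
`f` in the domain is sampled at finitely many nodes, each replaced by a nearby element of the core,
where `F` is consistent. Between nodes the powers of `F` follow the linear interpolation, and
stability lets the local errors add up. Equiboundedness and density of the domain extend the limit
to all `f`. -/

namespace NonautonomousSplitting

/-! ### Chernoff's product formula for a given limit semigroup. -/

section Chernoff

variable {E : Type*} [NormedAddCommGroup E] [NormedSpace ℝ E]

/-- A strongly continuous semigroup of bounded operators on `E`. -/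
structure IsStronglyContinuousSemigroup (S : ℝ≥0 → E →L[ℝ] E) : Prop where
  zero : S 0 = 1
  add : ∀ s t, S (s + t) = S s * S t
  cont : ∀ f, Continuous fun t => S t f

/-- The graph of the right derivative at `0` of an operator-valued function. -/
def rightDerivGraph (S : ℝ≥0 → E →L[ℝ] E) : Set (E × E) :=
  {p | Tendsto (fun h : ℝ≥0 => (h : ℝ)⁻¹ • (S h p.1 - p.1)) (𝓝[>] 0) (𝓝 p.2)}

theorem tendsto_sub_toNNReal (t : ℝ) :
    Tendsto (fun y : ℝ => (y - t).toNNReal) (𝓝[>] t) (𝓝[>] 0) := by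
  refine tendsto_nhdsWithin_iff.2 ⟨?_, ?_⟩
  · have : Continuous fun y : ℝ => (y - t).toNNReal := by fun_prop
    have h := this.tendsto t
    rw [sub_self, Real.toNNReal_zero] at h
    exact h.mono_left nhdsWithin_le_nhds
  · filter_upwards [self_mem_nhdsWithin] with y hy
    simpa using hy

theorem tendsto_coe_nhdsGT_zero :
    Tendsto (fun h : ℝ≥0 => (h : ℝ)) (𝓝[>] 0) (𝓝[>] 0) := by
  refine tendsto_nhdsWithin_iff.2 ⟨?_, ?_⟩
  · have h := NNReal.continuous_coe.tendsto 0
    exact h.mono_left nhdsWithin_le_nhds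
  · filter_upwards [self_mem_nhdsWithin] with y hy
    simpa using hy

namespace IsStronglyContinuousSemigroup

variable {S : ℝ≥0 → E →L[ℝ] E}

theorem continuous_orbit (hS : IsStronglyContinuousSemigroup S) (f : E) :
    Continuous fun τ : ℝ => S τ.toNNReal f :=
  (hS.cont f).comp continuous_real_toNNReal

theorem mem_rightDerivGraph_apply (hS : IsStronglyContinuousSemigroup S) {f g : E}
    (hfg : (f, g) ∈ rightDerivGraph S) (t : ℝ≥0) : (S t f, S t g) ∈ rightDerivGraph S := by
  have h := ((S t).continuous.tendsto g).comp hfg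
  refine h.congr fun r => ?_
  have : S r (S t f) = S t (S r f) := by
    rw [← mul_apply_eq_comp, ← hS.add, add_comm, hS.add,
      mul_apply_eq_comp]
  simp [this]

theorem hasDerivWithinAt_orbit (hS : IsStronglyContinuousSemigroup S) {f g : E}
    (hfg : (f, g) ∈ rightDerivGraph S) {t : ℝ} (ht : 0 ≤ t) :
    HasDerivWithinAt (fun τ : ℝ => S τ.toNNReal f) (S t.toNNReal g) (Ici t) t := by
  rw [← hasDerivWithinAt_Ioi_iff_Ici, hasDerivWithinAt_iff_tendsto_slope' (by simp)]
  have h := ((((S t.toNNReal).continuous.tendsto g).comp hfg).comp (tendsto_sub_toNNReal t))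
  refine h.congr' ?_
  filter_upwards [self_mem_nhdsWithin] with y hy
  have hy : t < y := hy
  have h1 : y.toNNReal = t.toNNReal + (y - t).toNNReal := by
    rw [← Real.toNNReal_add ht (by linarith)]
    congr 1
    ring
  simp only [Function.comp_apply, slope, vsub_eq_sub, h1, hS.add, mul_apply_eq_comp,
    map_smul, map_sub]
  rw [Real.coe_toNNReal _ (by linarith : 0 ≤ y - t)]

/-- Mean value inequality for the orbit minus its linear part at `a`; right derivatives suffice.
This bounds the error of a linear step along the orbit by the oscillation of `S(τ) g`. -/
theorem norm_orbit_sub_sub_le (hS : IsStronglyContinuousSemigroup S) {f g : E}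
    (hfg : (f, g) ∈ rightDerivGraph S) {a b C : ℝ} (ha : 0 ≤ a) (hab : a ≤ b)
    (hC : ∀ τ ∈ Ico a b, ‖S τ.toNNReal g - S a.toNNReal g‖ ≤ C) :
    ‖S b.toNNReal f - S a.toNNReal f - (b - a) • S a.toNNReal g‖ ≤ C * (b - a) := by
  have h := norm_image_sub_le_of_norm_deriv_right_le_segment (a := a) (b := b) (C := C)
    (f := fun τ : ℝ => S τ.toNNReal f - (τ - a) • S a.toNNReal g)
    (f' := fun τ => S τ.toNNReal g - S a.toNNReal g)
    ((hS.continuous_orbit f).continuousOn.sub (by fun_prop))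
    (fun τ hτ => (hS.hasDerivWithinAt_orbit hfg (ha.trans hτ.1)).sub (by
      simpa using (((hasDerivWithinAt_id τ (Ici τ)).sub_const a).smul_const (S a.toNNReal g))))
    hC b ⟨hab, le_rfl⟩
  convert h using 2
  simp
  abel

/-- The averages `h⁻¹ ∫₀ʰ S(τ) f dτ` lie in the domain and tend to `f` as `h ↓ 0`. -/
theorem dense_domain [CompleteSpace E] (hS : IsStronglyContinuousSemigroup S) :
    Dense (Prod.fst '' rightDerivGraph S) := by
  intro f
  set u : ℝ → E := fun τ => S τ.toNNReal f with hu
  have huc : Continuous u := hS.continuous_orbit f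
  set P : ℝ → E := fun r => ∫ τ in (0 : ℝ)..r, u τ with hP
  have hPd : ∀ r, HasDerivAt P (u r) r := fun r => huc.integral_hasStrictDerivAt 0 r |>.hasDerivAt
  have hint : ∀ a b : ℝ, IntervalIntegrable u MeasureTheory.volume a b :=
    fun a b => huc.intervalIntegrable a b
  -- By the semigroup law `S r` shifts the window of integration to `[r, h + r]`, so difference
  -- quotients of `S` at `P h` become those of `P` at `h` and at `0`.
  have hSP : ∀ r h : ℝ≥0, S r (P h) = P (h + r) - P r := by
    intro r h
    rw [hP]
    simp only
    rw [← ContinuousLinearMap.intervalIntegral_comp_comm _ (hint _ _),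
      intervalIntegral.integral_interval_sub_left (hint _ _) (hint _ _)]
    have h1 := intervalIntegral.integral_comp_add_left (a := 0) (b := (h : ℝ)) u (r : ℝ)
    rw [add_zero, add_comm (r : ℝ) h] at h1
    rw [← h1]
    refine intervalIntegral.integral_congr fun τ hτ => ?_
    rw [uIcc_of_le h.coe_nonneg] at hτ
    simp only [hu]
    rw [Real.toNNReal_add r.coe_nonneg hτ.1, hS.add, Real.toNNReal_coe, mul_apply_eq_comp]
  have hmem : ∀ h : ℝ≥0, (P h, u h - u 0) ∈ rightDerivGraph S := by
    intro h
    have h1 := (hPd h).tendsto_slope_zero.mono_left (nhdsWithin_mono _ (fun x (hx : 0 < x) => hx.ne'))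
    have h2 := (hPd 0).tendsto_slope_zero.mono_left (nhdsWithin_mono _ (fun x (hx : 0 < x) => hx.ne'))
    refine ((h1.sub h2).comp tendsto_coe_nhdsGT_zero).congr fun r => ?_
    have h0 : P 0 = 0 := by simp [hP]
    simp only [Function.comp_apply, hSP, zero_add, h0, sub_zero, ← smul_sub]
    congr 1
    abel
  have hlim : Tendsto (fun h : ℝ≥0 => (h : ℝ)⁻¹ • P h) (𝓝[>] 0) (𝓝 f) := by
    have h2 := (hPd 0).tendsto_slope_zero.mono_left (nhdsWithin_mono _ (fun x (hx : 0 < x) => hx.ne'))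
    have h0 : P 0 = 0 := by simp [hP]
    have h3 := h2.comp tendsto_coe_nhdsGT_zero
    simpa [h0, hu, hS.zero, Function.comp_def] using h3
  refine mem_closure_of_tendsto hlim (Eventually.of_forall fun h => ?_)
  refine ⟨((h : ℝ)⁻¹ • P h, (h : ℝ)⁻¹ • (u h - u 0)), ?_, rfl⟩
  refine ((hmem h).const_smul ((h : ℝ)⁻¹)).congr fun r => ?_
  rw [smul_comm]
  simp [smul_sub]

end IsStronglyContinuousSemigroup

/-- Telescoping: the total error is the sum of the block errors, each transported to the end by a
power of `F`, of norm at most `C`. -/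
theorem norm_pow_apply_sub_le_sum (F : E →L[ℝ] E) {a : ℕ → ℕ} (ha : Monotone a) (v : ℕ → E)
    (e : ℕ → ℝ) {C : ℝ} {m : ℕ} (hF : ∀ i ≤ a m, ‖F ^ i‖ ≤ C)
    (h : ∀ j < m, ‖(F ^ (a (j + 1) - a j)) (v j) - v (j + 1)‖ ≤ e j) :
    ‖(F ^ (a m - a 0)) (v 0) - v m‖ ≤ C * ∑ j ∈ Finset.range m, e j := by
  have h1 := Finset.sum_range_sub' (fun j => (F ^ (a m - a j)) (v j)) m
  simp only [Nat.sub_self, pow_zero, one_apply_eq_self] at h1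
  rw [← h1, Finset.mul_sum]
  refine norm_sum_le_of_le _ fun j hj => ?_
  have hj : j < m := Finset.mem_range.1 hj
  have hm : a (j + 1) ≤ a m := ha hj
  have hj' : a j ≤ a (j + 1) := ha (Nat.le_succ j)
  have h2 : a m - a j = (a m - a (j + 1)) + (a (j + 1) - a j) := by omega
  rw [h2, pow_add, mul_apply_eq_comp, ← map_sub]
  exact (ContinuousLinearMap.le_opNorm _ _).trans (mul_le_mul (hF _ (Nat.sub_le _ _)) (h j hj)
    (norm_nonneg _) ((norm_nonneg _).trans (hF 0 (Nat.zero_le _))))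

/-- Comparison of `F ^ K` with the linear interpolation from `w` to `w'`. -/
theorem norm_pow_apply_sub_le (F : E →L[ℝ] E) {C h : ℝ} {K : ℕ} (hh : 0 < h)
    (hF : ∀ i ≤ K, ‖F ^ i‖ ≤ C) (w w' g g' : E) (hK : 0 < K) :
    ‖(F ^ K) w - w'‖ ≤ C * (K * h * (‖h⁻¹ • (F w - w) - g‖ + ‖h⁻¹ • (F w' - w') - g'‖ + ‖g' - g‖) +
      ‖(K * h) • g - (w' - w)‖) := by
  have hK' : (0 : ℝ) < K := by exact_mod_cast hK
  set α := ‖h⁻¹ • (F w - w) - g‖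
  set α' := ‖h⁻¹ • (F w' - w') - g'‖
  set v : ℕ → E := fun k => w + ((k : ℝ) / K) • (w' - w) with hv
  have key := norm_pow_apply_sub_le_sum F (a := id) monotone_id v
    (fun _ => h * (α + α' + ‖g' - g‖) + (K : ℝ)⁻¹ * ‖(K * h) • g - (w' - w)‖) (C := C) (m := K) hF ?_
  · simp only [id, hv, Nat.cast_zero, zero_div, zero_smul, add_zero, Nat.sub_zero, Finset.sum_const,
      Finset.card_range, nsmul_eq_mul] at key
    rw [div_self hK'.ne', one_smul, add_sub_cancel] at key
    refine key.trans_eq ?_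
    field_simp
  · intro k hk
    have hkK : (k : ℝ) / K ≤ 1 := by
      rw [div_le_one hK']
      exact_mod_cast hk.le
    set θ : ℝ := (k : ℝ) / K
    have hθ : 0 ≤ θ := by positivity
    have hk1 : (((k + 1 : ℕ) : ℝ) / K) = θ + (K : ℝ)⁻¹ := by
      simp only [θ]
      push_cast
      field_simp
    -- By linearity of `F` the defect at an interpolated point is the convex combination of the
    -- defects at the endpoints, up to the drift `θ • (g' - g)` and the mismatch between `w' - w`
    -- and `(K * h) • g`.
    have e1 : (F ^ (id (k + 1) - id k)) (v k) - v (k + 1) =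
        h • ((1 - θ) • (h⁻¹ • (F w - w) - g) + θ • (h⁻¹ • (F w' - w') - g') + θ • (g' - g)) +
          (K : ℝ)⁻¹ • ((K * h) • g - (w' - w)) := by
      simp only [id, Nat.add_sub_cancel_left, pow_one, hv, hk1, map_add, map_smul, map_sub]
      have : h * h⁻¹ = 1 := mul_inv_cancel₀ hh.ne'
      have h3 : (K : ℝ)⁻¹ * (K * h) = h := by field_simp
      simp only [smul_add, smul_sub, smul_smul, h3]
      have e3 : h * (θ * h⁻¹) = θ := by field_simp
      have e2 : h * ((1 - θ) * h⁻¹) = 1 - θ := by field_simp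
      simp only [e2, e3]
      module
    rw [e1]
    refine (norm_add_le _ _).trans (add_le_add ?_ ?_)
    · rw [norm_smul, Real.norm_of_nonneg hh.le]
      refine mul_le_mul_of_nonneg_left ?_ hh.le
      refine (norm_add₃_le).trans (add_le_add (add_le_add ?_ ?_) ?_)
      · rw [norm_smul, Real.norm_of_nonneg (by linarith)]
        exact mul_le_of_le_one_left (norm_nonneg _) (by linarith)
      · rw [norm_smul, Real.norm_of_nonneg hθ]
        exact mul_le_of_le_one_left (norm_nonneg _) hkK
      · rw [norm_smul, Real.norm_of_nonneg hθ]
        exact mul_le_of_le_one_left (norm_nonneg _) hkK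
    · rw [norm_smul, norm_inv, Real.norm_of_nonneg hK'.le]

/-- The step `t / n` is also the step of `i` substeps for the shorter time `i * (t / n) ≤ t`, so the
hypothesis at that time applies; `|ω|` makes the bound uniform in `i`. -/
theorem norm_pow_div_le {F : ℝ≥0 → E →L[ℝ] E} {M ω : ℝ} (hM : 1 ≤ M)
    (hF : ∀ (t : ℝ≥0) (n : ℕ), 1 ≤ n → ‖F (t / n) ^ n‖ ≤ M * Real.exp (ω * t)) (t : ℝ≥0)
    {n i : ℕ} (hi : i ≤ n) : ‖F (t / n) ^ i‖ ≤ M * Real.exp (|ω| * t) := by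
  have ht := t.coe_nonneg
  rcases Nat.eq_zero_or_pos i with rfl | hi0
  · rw [pow_zero]
    refine (ContinuousLinearMap.norm_id_le).trans ?_
    have : 1 ≤ Real.exp (|ω| * t) := Real.one_le_exp (by positivity)
    nlinarith
  · have hn : (0 : ℝ) < n := by exact_mod_cast hi0.trans_le hi
    have hi' : (0 : ℝ≥0) < i := by exact_mod_cast hi0
    have h := hF (i * (t / n)) i hi0
    rw [mul_div_cancel_left₀ _ hi'.ne'] at h
    refine h.trans (mul_le_mul_of_nonneg_left (Real.exp_le_exp.2 ?_) (by linarith))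
    push_cast
    have hin : (i : ℝ) ≤ n := by exact_mod_cast hi
    have h1 : (i : ℝ) * (t / n) ≤ t := by
      rw [mul_div_assoc', div_le_iff₀ hn]
      nlinarith
    exact mul_le_mul (le_abs_self ω) h1 (by positivity) (abs_nonneg ω)

theorem tendsto_div_natCast_nhdsGT {t : ℝ≥0} (ht : 0 < t) :
    Tendsto (fun n : ℕ => t / n) atTop (𝓝[>] 0) := by
  refine tendsto_nhdsWithin_iff.2 ⟨?_, ?_⟩
  · rw [← NNReal.tendsto_coe]
    simpa using tendsto_const_div_atTop_nhds_zero_nat (t : ℝ)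
  · filter_upwards [eventually_gt_atTop 0] with n hn
    exact div_pos ht (by exact_mod_cast hn)

theorem tendsto_floor_sub_floor_mul_div (t : ℝ) {m : ℕ} (hm : 0 < m) (j : ℕ) :
    Tendsto (fun n : ℕ => ((⌊((j + 1 : ℕ) : ℝ) / m * n⌋₊ - ⌊(j : ℝ) / m * n⌋₊ : ℕ) : ℝ) * (t / n))
      atTop (𝓝 (t / m)) := by
  have h1 : ∀ a : ℝ, 0 ≤ a → Tendsto (fun n : ℕ => (⌊a * n⌋₊ : ℝ) / n) atTop (𝓝 a) := fun a ha =>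
    (tendsto_nat_floor_mul_div_atTop ha).comp tendsto_natCast_atTop_atTop
  have h2 := ((h1 (((j + 1 : ℕ) : ℝ) / m) (by positivity)).sub
    (h1 ((j : ℝ) / m) (by positivity))).mul_const t
  have h3 : (((j + 1 : ℕ) : ℝ) / m - (j : ℝ) / m) * t = t / m := by
    push_cast
    ring
  rw [h3] at h2
  refine h2.congr fun n => ?_
  rw [Nat.cast_sub]
  · ring
  · apply Nat.floor_mono
    gcongr
    simp

/-- A discrete evolution that is consistent along finitely many nodes `w 0, …, w m` stays close to
them. -/
theorem eventually_norm_pow_apply_sub_le {F : ℝ≥0 → E →L[ℝ] E} {C : ℝ} {t : ℝ≥0} (ht : 0 < t)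
    (hF : ∀ n i : ℕ, i ≤ n → ‖F (t / n) ^ i‖ ≤ C) {m : ℕ} (hm : 0 < m) (w g : ℕ → E)
    (hw : ∀ j, (w j, g j) ∈ rightDerivGraph F) {c : ℝ}
    (hc : ∀ j < m, (t / m : ℝ) * ‖g (j + 1) - g j‖ + ‖(t / m : ℝ) • g j - (w (j + 1) - w j)‖ < c) :
    ∀ᶠ n : ℕ in atTop, ‖(F (t / n) ^ n) (w 0) - w m‖ ≤ C * (m * (C * c)) := by
  have hm' : (0 : ℝ) < m := by exact_mod_cast hm
  have ht' : (0 : ℝ) < t := ht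
  have hC : 0 ≤ C := (norm_nonneg _).trans (hF 0 0 le_rfl)
  -- `a n j` is the number of steps of size `t / n` made before node `j`. As `n` grows with `m`
  -- fixed, each block lasts a time tending to `t / m`, and consistency is needed at finitely many
  -- nodes only.
  set a : ℕ → ℕ → ℕ := fun n j => ⌊(j : ℝ) / m * n⌋₊ with ha
  have hmono : ∀ n, Monotone (a n) := by
    intro n j k hjk
    apply Nat.floor_mono
    gcongr
  have ham : ∀ n, a n m = n := by
    intro n
    simp [ha, div_self hm'.ne']
  have ha0 : ∀ n, a n 0 = 0 := by
    intro n
    simp [ha]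
  have hcons : ∀ j, Tendsto (fun n : ℕ =>
      ‖(t / n : ℝ)⁻¹ • (F (t / n) (w j) - w j) - g j‖) atTop (𝓝 0) := by
    intro j
    have h1 := (hw j).comp (tendsto_div_natCast_nhdsGT ht)
    have h2 := (h1.sub_const (g j)).norm
    rw [sub_self, norm_zero] at h2
    refine h2.congr fun n => ?_
    simp
  have hK := fun j => tendsto_floor_sub_floor_mul_div (t : ℝ) hm j
  have hstep : ∀ j < m, ∀ᶠ n : ℕ in atTop,
      ‖(F (t / n) ^ (a n (j + 1) - a n j)) (w j) - w (j + 1)‖ ≤ C * c := by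
    intro j hj
    have hlim := ((hK j).mul (((hcons j).add (hcons (j + 1))).add_const ‖g (j + 1) - g j‖)).add
      (((hK j).smul_const (g j)).sub_const (w (j + 1) - w j)).norm
    simp only [add_zero, zero_add] at hlim
    filter_upwards [hlim.eventually_lt_const (hc j hj),
      (hK j).eventually_const_lt (show (0 : ℝ) < t / m by positivity),
      eventually_gt_atTop 0] with n h1 h2 hn
    have hn' : (0 : ℝ) < n := by exact_mod_cast hn
    have hKpos : 0 < a n (j + 1) - a n j := by
      rcases Nat.eq_zero_or_pos (a n (j + 1) - a n j) with h0 | h0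
      · simp only [ha] at h0
        rw [h0] at h2
        simp at h2
      · exact h0
    have hKn : a n (j + 1) - a n j ≤ n :=
      (Nat.sub_le _ _).trans ((hmono n (show j + 1 ≤ m from hj)).trans_eq (ham n))
    refine (norm_pow_apply_sub_le (F (t / n)) (h := t / n) (by positivity)
      (fun i hi => hF n i (hi.trans hKn)) (w j) (w (j + 1)) (g j) (g (j + 1)) hKpos).trans ?_
    exact mul_le_mul_of_nonneg_left h1.le hC
  have hall : ∀ᶠ n : ℕ in atTop, ∀ j ∈ Finset.range m,
      ‖(F (t / n) ^ (a n (j + 1) - a n j)) (w j) - w (j + 1)‖ ≤ C * c := by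
    rw [Filter.eventually_all_finset]
    exact fun j hj => hstep j (Finset.mem_range.1 hj)
  filter_upwards [hall] with n hn
  have h := norm_pow_apply_sub_le_sum (F (t / n)) (hmono n) w (fun _ => C * c) (C := C) (m := m)
    (by rw [ham]; exact fun i hi => hF n i hi) (fun j hj => hn j (Finset.mem_range.2 hj))
  simpa [ham, ha0] using h

/-- **Chernoff's product formula**, for a limit semigroup that is known to exist: if `F` is stable
and consistent with the generator of `S` on a core `D`, then `F (t / n) ^ n → S t` strongly. -/
theorem IsStronglyContinuousSemigroup.tendsto_pow_div [CompleteSpace E] {S F : ℝ≥0 → E →L[ℝ] E}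
    (hS : IsStronglyContinuousSemigroup S) {D : Set (E × E)} (hD : rightDerivGraph S ⊆ closure D)
    (hFD : D ⊆ rightDerivGraph F) {M ω : ℝ} (hM : 1 ≤ M)
    (hF : ∀ (t : ℝ≥0) (n : ℕ), 1 ≤ n → ‖F (t / n) ^ n‖ ≤ M * Real.exp (ω * t))
    {t : ℝ≥0} (ht : 0 < t) (f : E) :
    Tendsto (fun n : ℕ => (F (t / n) ^ n) f) atTop (𝓝 (S t f)) := by
  set C := M * Real.exp (|ω| * t) with hCdef
  have hC : 0 < C := by positivity
  have hFC : ∀ n i : ℕ, i ≤ n → ‖F (t / n) ^ i‖ ≤ C := fun n i hi => norm_pow_div_le hM hF t hi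
  have ht' : (0 : ℝ) < t := ht
  have hdom : ∀ f g, (f, g) ∈ rightDerivGraph S →
      Tendsto (fun n : ℕ => (F (t / n) ^ n) f) atTop (𝓝 (S t f)) := by
    intro f g hfg
    rw [Metric.tendsto_nhds]
    intro ε₀ hε₀
    -- The three terms are the errors from replacing the initial value by node `0`, from the `m`
    -- blocks, and from replacing the final value by node `m`.
    obtain ⟨ε, hε, hεε⟩ : ∃ ε > 0, C * ε + C * (C * (8 * ε * t)) + ε < ε₀ := by
      have hlim : Tendsto (fun ε : ℝ => C * ε + C * (C * (8 * ε * t)) + ε) (𝓝[>] 0) (𝓝 0) := by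
        have hc : Continuous fun ε : ℝ => C * ε + C * (C * (8 * ε * t)) + ε := by fun_prop
        simpa using (hc.tendsto 0).mono_left nhdsWithin_le_nhds
      obtain ⟨ε, h1, h2⟩ := ((hlim.eventually_lt_const hε₀).and self_mem_nhdsWithin).exists
      exact ⟨ε, h2, h1⟩
    obtain ⟨δ₀, hδ₀, hunif⟩ := Metric.uniformContinuousOn_iff.1
      ((isCompact_Icc (a := (0 : ℝ)) (b := t)).uniformContinuousOn_of_continuous
        (hS.continuous_orbit g).continuousOn) ε hε
    obtain ⟨m, hm⟩ := exists_nat_gt ((t : ℝ) / δ₀)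
    have hm' : (0 : ℝ) < m := lt_of_le_of_lt (by positivity) hm
    have hm0 : 0 < m := by exact_mod_cast hm'
    set δ : ℝ := t / m with hδdef
    have hδ : 0 < δ := by positivity
    have hδδ : δ < δ₀ := by
      rw [hδdef, div_lt_iff₀ hm']
      rw [div_lt_iff₀ hδ₀] at hm
      linarith
    have hmδ : m * δ = t := by
      rw [hδdef]
      field_simp
    set u : ℝ → E := fun τ => S τ.toNNReal f
    set v : ℝ → E := fun τ => S τ.toNNReal g
    -- The factor `min 1 δ` makes the position error of order `ε * δ`, so that it stays of order `ε`
    -- after summation over the `m = t / δ` nodes.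
    have hnode : ∀ j : ℕ, ∃ p ∈ D, ‖p.1 - u (j * δ)‖ < ε * min 1 δ ∧ ‖p.2 - v (j * δ)‖ < ε := by
      intro j
      have hcl := hD (hS.mem_rightDerivGraph_apply hfg ((j : ℝ) * δ).toNNReal)
      obtain ⟨p, hp, hdist⟩ := Metric.mem_closure_iff.1 hcl (ε * min 1 δ) (by positivity)
      rw [dist_comm, dist_eq_norm] at hdist
      refine ⟨p, hp, (norm_fst_le _).trans_lt hdist, ((norm_snd_le _).trans_lt hdist).trans_le ?_⟩
      exact mul_le_of_le_one_right hε.le (min_le_left _ _)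
    choose p hpD hp1 hp2 using hnode
    have hp1' : ∀ j, ‖(p j).1 - u (j * δ)‖ < ε * δ := fun j =>
      (hp1 j).trans_le (mul_le_mul_of_nonneg_left (min_le_right _ _) hε.le)
    have hp1'' : ∀ j, ‖(p j).1 - u (j * δ)‖ < ε := fun j =>
      (hp1 j).trans_le (mul_le_of_le_one_right hε.le (min_le_left _ _))
    -- The two terms contribute `3 * ε * δ` and `4 * ε * δ`; the constant `8` leaves room for strict
    -- inequality.
    have hstep : ∀ j < m, δ * ‖(p (j + 1)).2 - (p j).2‖ +
        ‖δ • (p j).2 - ((p (j + 1)).1 - (p j).1)‖ < 8 * ε * δ := by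
      intro j hj
      have hj1 : ((j : ℝ) + 1) ≤ m := by exact_mod_cast hj
      have hj0 : (0 : ℝ) ≤ j * δ := by positivity
      have hle : ((j + 1 : ℕ) : ℝ) * δ ≤ t := by
        push_cast
        nlinarith
      have hdiff : ((j + 1 : ℕ) : ℝ) * δ - j * δ = δ := by
        push_cast
        ring
      have hv : ∀ τ ∈ Icc ((j : ℝ) * δ) ((j + 1 : ℕ) * δ), ‖v τ - v (j * δ)‖ ≤ ε := by
        intro τ hτ
        rw [← dist_eq_norm]
        refine (hunif τ ⟨hj0.trans hτ.1, hτ.2.trans hle⟩ (j * δ) ⟨hj0, by linarith⟩ ?_).le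
        rw [Real.dist_eq, abs_of_nonneg (by linarith [hτ.1])]
        linarith [hτ.2]
      have h1 := hv ((j + 1 : ℕ) * δ) ⟨by linarith, le_rfl⟩
      have h2 := hS.norm_orbit_sub_sub_le hfg hj0 (by linarith : (j : ℝ) * δ ≤ (j + 1 : ℕ) * δ)
        (fun τ hτ => hv τ (Ico_subset_Icc_self hτ))
      rw [hdiff] at h2
      have h3 : ‖(p (j + 1)).2 - (p j).2‖ ≤ 3 * ε := by
        have e : (p (j + 1)).2 - (p j).2 = ((p (j + 1)).2 - v ((j + 1 : ℕ) * δ)) +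
          (v ((j + 1 : ℕ) * δ) - v (j * δ)) - ((p j).2 - v (j * δ)) := by abel
        rw [e]
        refine (norm_sub_le _ _).trans ?_
        have := norm_add_le ((p (j + 1)).2 - v ((j + 1 : ℕ) * δ))
          (v ((j + 1 : ℕ) * δ) - v (j * δ))
        linarith [hp2 j, hp2 (j + 1)]
      have h4 : ‖δ • (p j).2 - ((p (j + 1)).1 - (p j).1)‖ ≤ 4 * ε * δ := by
        have e : δ • (p j).2 - ((p (j + 1)).1 - (p j).1) = δ • ((p j).2 - v (j * δ)) +
            ((p j).1 - u (j * δ)) - ((p (j + 1)).1 - u ((j + 1 : ℕ) * δ)) -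
            (u ((j + 1 : ℕ) * δ) - u (j * δ) - δ • v (j * δ)) := by
          rw [smul_sub]
          abel
        rw [e]
        refine (norm_sub_le _ _).trans ?_
        have i1 := norm_sub_le (δ • ((p j).2 - v (j * δ)) + ((p j).1 - u (j * δ)))
          ((p (j + 1)).1 - u ((j + 1 : ℕ) * δ))
        have i2 := norm_add_le (δ • ((p j).2 - v (j * δ))) ((p j).1 - u (j * δ))
        have i3 : ‖δ • ((p j).2 - v (j * δ))‖ ≤ δ * ε := by
          rw [norm_smul, Real.norm_of_nonneg hδ.le]
          exact mul_le_mul_of_nonneg_left (hp2 j).le hδ.le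
        linarith [hp1' j, hp1' (j + 1)]
      have h5 := mul_le_mul_of_nonneg_left h3 hδ.le
      have : 0 < ε * δ := by positivity
      linarith
    have hev := eventually_norm_pow_apply_sub_le ht hFC hm0 (fun j => (p j).1) (fun j => (p j).2)
      (fun j => hFD (hpD j)) hstep
    filter_upwards [hev] with n hn
    rw [dist_eq_norm]
    have e : (F (t / n) ^ n) f - S t f = ((F (t / n) ^ n) (p 0).1 - (p m).1) -
        (F (t / n) ^ n) ((p 0).1 - f) + ((p m).1 - S t f) := by
      rw [map_sub]
      abel
    have h0 : ‖(F (t / n) ^ n) ((p 0).1 - f)‖ ≤ C * ε := by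
      refine (ContinuousLinearMap.le_opNorm _ _).trans
        (mul_le_mul (hFC n n le_rfl) ?_ (norm_nonneg _) hC.le)
      have := (hp1'' 0).le
      simpa [u, hS.zero] using this
    have hmm : ‖(p m).1 - S t f‖ < ε := by
      have := hp1'' m
      rwa [hmδ, show u t = S t f by simp [u]] at this
    have heq : (m : ℝ) * (C * (8 * ε * δ)) = C * (8 * ε * t) := by
      rw [← hmδ]
      ring
    rw [heq] at hn
    rw [e]
    refine (norm_add_le _ _).trans_lt ?_
    have := norm_sub_le ((F (t / n) ^ n) (p 0).1 - (p m).1) ((F (t / n) ^ n) ((p 0).1 - f))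
    linarith
  rw [Metric.tendsto_nhds]
  intro ε hε
  -- `c` dominates the norms of both `F (t / n) ^ n` and `S t`, so replacing `f` by a nearby `f₁` in
  -- the domain costs less than `ε / 2`.
  set c := C + ‖S t‖ + 1 with hc
  have hcpos : 0 < c := by positivity
  obtain ⟨f', ⟨⟨f₁, g₁⟩, hfg, rfl⟩, hf⟩ := Metric.mem_closure_iff.1 (hS.dense_domain f)
    (ε / (2 * c)) (by positivity)
  filter_upwards [(Metric.tendsto_nhds.1 (hdom f₁ g₁ hfg)) (ε / 2) (by positivity)] with n hn
  rw [dist_eq_norm] at hn hf ⊢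
  have e : (F (t / n) ^ n) f - S t f = ((F (t / n) ^ n) f₁ - S t f₁) +
      (F (t / n) ^ n) (f - f₁) - S t (f - f₁) := by
    simp only [map_sub]
    abel
  have h1 : ‖(F (t / n) ^ n) (f - f₁)‖ ≤ C * ‖f - f₁‖ := ContinuousLinearMap.le_of_opNorm_le _ (hFC n n le_rfl) _
  have h2 := (S t).le_opNorm (f - f₁)
  have h3 : c * ‖f - f₁‖ < ε / 2 := by
    have := mul_lt_mul_of_pos_left hf hcpos
    have e2 : c * (ε / (2 * c)) = ε / 2 := by field_simp
    rwa [e2] at this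
  rw [e]
  refine (norm_sub_le _ _).trans_lt ?_
  have h4 := norm_add_le ((F (t / n) ^ n) f₁ - S t f₁) ((F (t / n) ^ n) (f - f₁))
  have h5 := norm_nonneg (f - f₁)
  rw [hc] at h3
  linarith

end Chernoff

/-! ### Translations on `C₀(ℝ, X)`. -/

section VanishingAtInfinity

variable {X : Type*} [NormedAddCommGroup X]

theorem c0_norm_coe_le (f : C₀(ℝ, X)) (s : ℝ) : ‖f s‖ ≤ ‖f‖ :=
  f.toBCF.norm_coe_le_norm s

theorem c0_norm_le {f : C₀(ℝ, X)} {C : ℝ} (hC : 0 ≤ C) : ‖f‖ ≤ C ↔ ∀ s, ‖f s‖ ≤ C :=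
  BoundedContinuousFunction.norm_le (f := f.toBCF) hC

variable [NormedSpace ℝ X]

/-- The translation `(R f)(s) = f(s + c)` on `C₀(ℝ, X)`. -/
noncomputable def translation (c : ℝ) : C₀(ℝ, X) →L[ℝ] C₀(ℝ, X) :=
  LinearMap.mkContinuous
    { toFun := fun f => f.comp (Homeomorph.addRight c).toCocompactMap
      map_add' := fun _ _ => rfl
      map_smul' := fun _ _ => rfl } 1 fun f => by
    rw [one_mul, c0_norm_le (norm_nonneg _)]
    exact fun s => c0_norm_coe_le f _

@[simp]
theorem translation_apply (c : ℝ) (f : C₀(ℝ, X)) (s : ℝ) : translation c f s = f (s + c) :=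
  rfl

theorem norm_translation_le (c : ℝ) : ‖(translation c : C₀(ℝ, X) →L[ℝ] C₀(ℝ, X))‖ ≤ 1 :=
  LinearMap.mkContinuous_norm_le _ zero_le_one _

theorem tendsto_translation (f : C₀(ℝ, X)) :
    Tendsto (fun h : ℝ≥0 => translation h f) (𝓝[>] 0) (𝓝 f) := by
  rw [Metric.tendsto_nhds]
  intro ε hε
  obtain ⟨δ, hδ, hf⟩ := Metric.uniformContinuous_iff.1 (ZeroAtInftyContinuousMap.uniformContinuous f)
    (ε / 2) (half_pos hε)
  have hev : ∀ᶠ h : ℝ≥0 in 𝓝[>] 0, (h : ℝ) < δ :=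
    (tendsto_coe_nhdsGT_zero.mono_right nhdsWithin_le_nhds).eventually_lt_const hδ
  filter_upwards [hev] with h hh
  rw [dist_eq_norm]
  refine lt_of_le_of_lt ?_ (half_lt_self hε)
  rw [c0_norm_le (half_pos hε).le]
  intro s
  rw [ZeroAtInftyContinuousMap.sub_apply, translation_apply, ← dist_eq_norm]
  exact (hf (by simpa using hh)).le

/-- `f'` vanishes at infinity and is therefore uniformly continuous; the mean value inequality then
bounds the difference quotient error uniformly in `s`. -/
theorem derivGraph_subset_rightDerivGraph_translation :
    derivGraph X ⊆ rightDerivGraph fun h : ℝ≥0 => translation h := by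
  rintro ⟨f, f'⟩ hf
  change Tendsto (fun h : ℝ≥0 => (h : ℝ)⁻¹ • (translation h f - f)) (𝓝[>] 0) (𝓝 f')
  rw [Metric.tendsto_nhds]
  intro ε hε
  obtain ⟨δ, hδ, hu⟩ := Metric.uniformContinuous_iff.1
    (ZeroAtInftyContinuousMap.uniformContinuous f') (ε / 2) (half_pos hε)
  have hev : ∀ᶠ h : ℝ≥0 in 𝓝[>] 0, (h : ℝ) < δ :=
    (tendsto_coe_nhdsGT_zero.mono_right nhdsWithin_le_nhds).eventually_lt_const hδ
  filter_upwards [hev, self_mem_nhdsWithin] with h hh hpos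
  have hpos : (0 : ℝ) < h := hpos
  rw [dist_eq_norm]
  refine lt_of_le_of_lt ?_ (half_lt_self hε)
  rw [c0_norm_le (half_pos hε).le]
  intro s
  have key := norm_image_sub_le_of_norm_deriv_right_le_segment (a := s) (b := s + h) (C := ε / 2)
    (f := fun τ : ℝ => f τ - (τ - s) • f' s) (f' := fun τ => f' τ - f' s)
    ((map_continuous f).continuousOn.sub (by fun_prop))
    (fun τ _ => (hf τ).hasDerivWithinAt.sub (by
      simpa using (((hasDerivWithinAt_id τ (Ici τ)).sub_const s).smul_const (f' s))))
    (fun τ hτ => by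
      rw [← dist_eq_norm]
      refine (hu ?_).le
      rw [Real.dist_eq, abs_of_nonneg (by linarith [hτ.1])]
      linarith [hτ.2]) (s + h) ⟨by linarith, le_rfl⟩
  simp only [add_sub_cancel_left, sub_self, zero_smul, sub_zero] at key
  have e : ((h : ℝ)⁻¹ • (translation h f - f) - f') s =
      (h : ℝ)⁻¹ • (f (s + h) - (h : ℝ) • f' s - f s) := by
    have : (h : ℝ)⁻¹ * h = 1 := inv_mul_cancel₀ hpos.ne'
    simp only [ZeroAtInftyContinuousMap.sub_apply, ZeroAtInftyContinuousMap.smul_apply,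
      translation_apply, smul_sub, smul_smul, this, one_smul]
    abel
  rw [e, norm_smul, norm_inv, Real.norm_of_nonneg hpos.le, inv_mul_le_iff₀ hpos]
  linarith

/-- A continuous function with compact support through a prescribed value. -/
theorem exists_c0_apply_eq (s : ℝ) (x : X) : ∃ f : C₀(ℝ, X), f s = x := by
  refine ⟨⟨⟨fun r => max 0 (1 - |r - s|) • x, by fun_prop⟩, ?_⟩, ?_⟩
  · refine (HasCompactSupport.intro (isCompact_closedBall s 1) fun r hr => ?_).is_zero_at_infty
    rw [Metric.mem_closedBall, Real.dist_eq, not_le] at hr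
    simp [max_eq_left (by linarith : 1 - |r - s| ≤ 0)]
  · change max 0 (1 - |s - s|) • x = x
    simp

end VanishingAtInfinity

theorem tendsto_apply_of_bounded {ι E : Type*} [NormedAddCommGroup E] [NormedSpace ℝ E]
    {l : Filter ι} {L : ι → E →L[ℝ] E} {x : ι → E} {y z : E} {C : ℝ} (hC : ∀ᶠ i in l, ‖L i‖ ≤ C)
    (hL : Tendsto (fun i => L i y) l (𝓝 z)) (hx : Tendsto x l (𝓝 y)) :
    Tendsto (fun i => L i (x i)) l (𝓝 z) := by
  have h1 : Tendsto (fun i => L i (x i - y)) l (𝓝 0) := by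
    have h2 : Tendsto (fun i => C * ‖x i - y‖) l (𝓝 0) := by
      simpa using (hx.sub_const y).norm.const_mul C
    refine squeeze_zero_norm' ?_ h2
    filter_upwards [hC] with i hi
    exact ContinuousLinearMap.le_of_opNorm_le _ hi _
  simpa using h1.add hL

/-! ### Estimates for evolution families and reordering of products. -/

section Family

variable {𝕜 X : Type*} [RCLike 𝕜] [NormedAddCommGroup X] [NormedSpace 𝕜 X]

theorem IsEvolutionFamily.exists_norm_le {U : ℝ → ℝ → X →L[𝕜] X}
    (hU : IsEvolutionFamily U) :
    ∃ M ω : ℝ, 1 ≤ M ∧ 0 ≤ ω ∧ ∀ (t : ℝ≥0) (s : ℝ), ‖U s (s - t)‖ ≤ M * Real.exp (ω * t) := by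
  obtain ⟨M, ω, hM, h⟩ := hU.expBounded
  refine ⟨M, |ω|, hM, abs_nonneg ω, fun t s => ?_⟩
  have ht := t.coe_nonneg
  have := h s (s - t) (by linarith)
  rw [sub_sub_cancel] at this
  refine this.trans ?_
  gcongr
  exact le_abs_self ω

/-- Continuity jointly in `s` and the step is what allows uniformity over compact sets of `s`. -/
theorem IsEvolutionFamily.tendsto_evolve {U : ℝ → ℝ → X →L[𝕜] X} (hU : IsEvolutionFamily U)
    (f : C₀(ℝ, X)) (s₀ : ℝ) :
    Tendsto (fun p : ℝ × ℝ≥0 => U p.1 (p.1 - p.2) (f (p.1 - p.2))) (𝓝 (s₀, 0)) (𝓝 (f s₀)) := by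
  obtain ⟨M, ω, hM, hω, h⟩ := hU.exists_norm_le
  have h1 : Tendsto (fun p : ℝ × ℝ≥0 => U p.1 (p.1 - p.2) (f s₀)) (𝓝 (s₀, 0)) (𝓝 (f s₀)) := by
    have hc : Continuous fun p : ℝ × ℝ≥0 => U p.1 (p.1 - p.2) (f s₀) := by
      refine (hU.strongCont (f s₀)).comp_continuous
        (f := fun p : ℝ × ℝ≥0 => (p.1, p.1 - (p.2 : ℝ))) (by fun_prop) ?_
      intro p
      simp
    have := hc.tendsto (s₀, 0)
    simpa [hU.diag] using this
  have h2 : Tendsto (fun p : ℝ × ℝ≥0 => U p.1 (p.1 - p.2) (f (p.1 - p.2) - f s₀)) (𝓝 (s₀, 0))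
      (𝓝 0) := by
    have hf : Tendsto (fun p : ℝ × ℝ≥0 => M * Real.exp (ω * p.2) * ‖f (p.1 - p.2) - f s₀‖)
        (𝓝 (s₀, 0)) (𝓝 0) := by
      have hfc := map_continuous f
      have hc : Continuous fun p : ℝ × ℝ≥0 =>
          M * Real.exp (ω * p.2) * ‖f (p.1 - p.2) - f s₀‖ := by fun_prop
      simpa using hc.tendsto (s₀, 0)
    exact squeeze_zero_norm (fun p => ContinuousLinearMap.le_of_opNorm_le _ (h p.2 p.1) _) hf
  simpa using h2.add h1

theorem timeOrderedProd_eq_reverseTimeOrderedProd (F G : ℕ → X →L[𝕜] X) (n : ℕ)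
    (h : ∀ p < n, F p = G (n - 1 - p)) : timeOrderedProd F n = reverseTimeOrderedProd G n := by
  unfold timeOrderedProd reverseTimeOrderedProd
  congr 1
  apply List.ext_getElem
  · simp
  · intro i h1 h2
    have hi : i < n := by simpa using h2
    simp only [List.getElem_reverse, List.getElem_map, List.getElem_range, List.length_map,
      List.length_range]
    rw [h _ (by omega)]
    congr 1
    omega

end Family

/-! ### The evolution semigroup and the splitting operator. -/

section Evolution

variable {𝕜 X : Type*} [RCLike 𝕜] [NormedAddCommGroup X] [NormedSpace 𝕜 X] [NormedSpace ℝ X]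
  [IsScalarTower ℝ 𝕜 X] {U V : ℝ → ℝ → X →L[𝕜] X}

/-- The operators of the evolution semigroup on `C₀(ℝ, X)`, as bounded operators. -/
noncomputable def evolutionOperator (hU : IsEvolutionFamily U) (t : ℝ≥0) :
    C₀(ℝ, X) →L[ℝ] C₀(ℝ, X) :=
  LinearMap.mkContinuousOfExistsBound
    { toFun := evolutionSemigroup hU t
      map_add' := fun f g => by
        ext s
        exact map_add (U s (s - t)) (f (s - t)) (g (s - t))
      map_smul' := fun c f => by
        ext s
        exact ContinuousLinearMap.map_smul_of_tower (U s (s - t)) c (f (s - t)) } <| by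
    obtain ⟨M, ω, hM, -, h⟩ := hU.exists_norm_le
    refine ⟨M * Real.exp (ω * t), fun f => ?_⟩
    rw [c0_norm_le (by positivity)]
    intro s
    exact (ContinuousLinearMap.le_of_opNorm_le _ (h t s) _).trans
      (mul_le_mul_of_nonneg_left (c0_norm_coe_le f _) (by positivity))

theorem evolutionOperator_apply (hU : IsEvolutionFamily U) (t : ℝ≥0) (f : C₀(ℝ, X)) (s : ℝ) :
    evolutionOperator hU t f s = U s (s - t) (f (s - t)) :=
  rfl

theorem exists_norm_evolutionOperator_le (hU : IsEvolutionFamily U) :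
    ∃ M ω : ℝ, 1 ≤ M ∧ 0 ≤ ω ∧ ∀ t : ℝ≥0, ‖evolutionOperator hU t‖ ≤ M * Real.exp (ω * t) := by
  obtain ⟨M, ω, hM, hω, h⟩ := hU.exists_norm_le
  refine ⟨M, ω, hM, hω, fun t => ContinuousLinearMap.opNorm_le_bound _ (by positivity) fun f => ?_⟩
  rw [c0_norm_le (by positivity)]
  intro s
  exact (ContinuousLinearMap.le_of_opNorm_le _ (h t s) _).trans
      (mul_le_mul_of_nonneg_left (c0_norm_coe_le f _) (by positivity))

theorem eventually_norm_evolutionOperator_le (hU : IsEvolutionFamily U) :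
    ∃ C : ℝ, ∀ᶠ h : ℝ≥0 in 𝓝 0, ‖evolutionOperator hU h‖ ≤ C := by
  obtain ⟨M, ω, hM, hω, h⟩ := exists_norm_evolutionOperator_le hU
  refine ⟨M * Real.exp ω, ?_⟩
  filter_upwards [eventually_le_nhds (zero_lt_one : (0 : ℝ≥0) < 1)] with t ht
  refine (h t).trans ?_
  have ht : (t : ℝ) ≤ 1 := ht
  gcongr
  exact mul_le_of_le_one_right hω ht

/-- On a large ball joint continuity and compactness give uniform smallness; outside it both terms
are small because `f` vanishes at infinity. -/
theorem tendsto_evolutionOperator_zero (hU : IsEvolutionFamily U) (f : C₀(ℝ, X)) :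
    Tendsto (fun h : ℝ≥0 => evolutionOperator hU h f) (𝓝 0) (𝓝 f) := by
  obtain ⟨M, ω, hM, hω, hbd⟩ := hU.exists_norm_le
  rw [Metric.tendsto_nhds]
  intro ε hε
  set c := M * Real.exp ω with hc
  have hcpos : 0 < c := by positivity
  have htail : ∀ᶠ s in cocompact ℝ, ‖f s‖ < min (ε / 4) (ε / (4 * c)) := by
    have h1 := f.zero_at_infty'.norm
    rw [norm_zero] at h1
    exact h1.eventually_lt_const (by positivity)
  rw [← Metric.cobounded_eq_cocompact] at htail
  obtain ⟨R, -, hR⟩ := (Metric.hasBasis_cobounded_compl_closedBall (0 : ℝ)).eventually_iff.1 htail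
  -- Radius `R + 1`: for `h ≤ 1` and `s` outside this ball, `s - h` is still outside the ball of
  -- radius `R`.
  have hcpt := (isCompact_closedBall (0 : ℝ) (R + 1)).eventually_forall_of_forall_eventually
    (x₀ := (0 : ℝ≥0)) (P := fun h s => ‖U s (s - h) (f (s - h)) - f s‖ < ε / 2) (fun s₀ _ => by
      have h1 := hU.tendsto_evolve f s₀
      have h2 : Tendsto (fun p : ℝ × ℝ≥0 => f p.1) (𝓝 (s₀, 0)) (𝓝 (f s₀)) :=
        ((map_continuous f).comp continuous_fst).tendsto (s₀, (0 : ℝ≥0))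
      have h3 := (h1.sub h2).norm
      rw [sub_self, norm_zero] at h3
      have h4 := h3.eventually_lt_const (half_pos hε)
      exact (Continuous.tendsto continuous_swap ((0 : ℝ≥0), s₀)).eventually h4)
  filter_upwards [hcpt, eventually_le_nhds (zero_lt_one : (0 : ℝ≥0) < 1)] with h hh h1
  have h1 : (h : ℝ) ≤ 1 := h1
  have h0 := h.coe_nonneg
  rw [dist_eq_norm]
  refine lt_of_le_of_lt ?_ (half_lt_self hε)
  rw [c0_norm_le (half_pos hε).le]
  intro s
  rw [ZeroAtInftyContinuousMap.sub_apply, evolutionOperator_apply]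
  by_cases hs : s ∈ Metric.closedBall (0 : ℝ) (R + 1)
  · exact (hh s hs).le
  · rw [mem_closedBall_zero_iff, Real.norm_eq_abs, not_le] at hs
    have i1 : ‖f s‖ < ε / 4 := by
      refine (hR ?_).trans_le (min_le_left _ _)
      rw [mem_compl_iff, mem_closedBall_zero_iff, Real.norm_eq_abs, not_le]
      linarith
    have i2 : ‖f (s - h)‖ < ε / (4 * c) := by
      refine (hR ?_).trans_le (min_le_right _ _)
      rw [mem_compl_iff, mem_closedBall_zero_iff, Real.norm_eq_abs, not_le]
      have := abs_sub_abs_le_abs_sub s h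
      rw [abs_of_nonneg h0] at this
      linarith
    have i3 : ‖U s (s - h) (f (s - h))‖ ≤ ε / 4 := by
      have hb : ‖U s (s - h)‖ ≤ c := by
        refine (hbd h s).trans ?_
        rw [hc]
        gcongr
        exact mul_le_of_le_one_right hω h1
      refine (ContinuousLinearMap.le_of_opNorm_le _ hb _).trans ?_
      have := mul_le_mul_of_nonneg_left i2.le hcpos.le
      have e : c * (ε / (4 * c)) = ε / 4 := by field_simp
      rwa [e] at this
    refine (norm_sub_le _ _).trans ?_
    linarith

theorem isStronglyContinuousSemigroup_evolutionOperator (hU : IsEvolutionFamily U) :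
    IsStronglyContinuousSemigroup (evolutionOperator hU) := by
  have hadd : ∀ s t, evolutionOperator hU (s + t) =
      evolutionOperator hU s * evolutionOperator hU t := by
    intro s t
    ext f r
    have hs := s.coe_nonneg
    have ht := t.coe_nonneg
    rw [mul_apply_eq_comp]
    simp only [evolutionOperator_apply]
    have h1 : r - ((s + t : ℝ≥0) : ℝ) = r - s - t := by
      push_cast
      ring
    rw [h1, ← hU.comp r (r - s) (r - s - t) (by linarith) (by linarith)]
    rfl
  refine ⟨?_, hadd, fun f => ?_⟩
  · ext f r
    simp [evolutionOperator_apply, hU.diag]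
  · obtain ⟨M, ω, hM, hω, hb⟩ := exists_norm_evolutionOperator_le hU
    have hle : ∀ a b : ℝ≥0, a ≤ b → ‖evolutionOperator hU b f - evolutionOperator hU a f‖ ≤
        M * Real.exp (ω * a) * ‖evolutionOperator hU (b - a) f - f‖ := by
      intro a b hab
      have : evolutionOperator hU b f = evolutionOperator hU a (evolutionOperator hU (b - a) f) := by
        rw [← mul_apply_eq_comp, ← hadd, add_tsub_cancel_of_le hab]
      rw [this, ← map_sub]
      exact ContinuousLinearMap.le_of_opNorm_le _ (hb a) _
    rw [continuous_iff_continuousAt]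
    intro a
    -- With truncated subtraction `(b - a) + (a - b)` is `|a - b|`, and `a + b` dominates the
    -- smaller of the two times, so one majorant serves both sides of `a`.
    have hz : Tendsto (fun b : ℝ≥0 => M * Real.exp (ω * (a + b)) *
        ‖evolutionOperator hU ((b - a) + (a - b)) f - f‖) (𝓝 a) (𝓝 0) := by
      have h1 : Tendsto (fun b : ℝ≥0 => (b - a) + (a - b)) (𝓝 a) (𝓝 0) := by
        have hc : Continuous fun b : ℝ≥0 => (b - a) + (a - b) := by fun_prop
        simpa using hc.tendsto a
      have h2 := (((tendsto_evolutionOperator_zero hU f).comp h1).sub_const f).norm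
      have hc : Continuous fun b : ℝ≥0 => M * Real.exp (ω * (a + b)) := by fun_prop
      simpa using (hc.tendsto a).mul h2
    rw [ContinuousAt, tendsto_iff_norm_sub_tendsto_zero]
    refine squeeze_zero (fun _ => norm_nonneg _) (fun b => ?_) hz
    have ha := a.coe_nonneg
    have hb' := b.coe_nonneg
    rcases le_total a b with hab | hab
    · rw [tsub_eq_zero_of_le hab, add_zero]
      refine (hle a b hab).trans ?_
      gcongr
      linarith
    · rw [tsub_eq_zero_of_le hab, zero_add, norm_sub_rev]
      refine (hle b a hab).trans ?_
      gcongr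
      linarith

/-- One splitting step, `(F(h) f)(s) = V(s, s - h) U(s, s - h) f(s - h)`. -/
noncomputable def splittingOperator (hU : IsEvolutionFamily U) (hV : IsEvolutionFamily V)
    (h : ℝ≥0) : C₀(ℝ, X) →L[ℝ] C₀(ℝ, X) :=
  evolutionOperator hV h * translation h * evolutionOperator hU h

theorem splittingOperator_apply (hU : IsEvolutionFamily U) (hV : IsEvolutionFamily V) (h : ℝ≥0)
    (f : C₀(ℝ, X)) (s : ℝ) :
    splittingOperator hU hV h f s = V s (s - h) (U s (s - h) (f (s - h))) := by
  simp [splittingOperator, evolutionOperator_apply]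

theorem splittingOperator_pow_apply (hU : IsEvolutionFamily U) (hV : IsEvolutionFamily V) (h : ℝ≥0)
    (n : ℕ) (f : C₀(ℝ, X)) (s : ℝ) :
    (splittingOperator hU hV h ^ n) f s =
      reverseTimeOrderedProd (fun p => V (s - p * h) (s - (p + 1) * h) ∘L
        U (s - p * h) (s - (p + 1) * h)) n (f (s - n * h)) := by
  induction n generalizing f with
  | zero => simp [reverseTimeOrderedProd]
  | succ n ih =>
    rw [pow_succ, mul_apply_eq_comp, ih, splittingOperator_apply]
    have e : s - n * h - h = s - ((n : ℝ) + 1) * h := by ring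
    simp [reverseTimeOrderedProd, List.range_succ, e]

theorem norm_splittingOperator_pow_le (hU : IsEvolutionFamily U) (hV : IsEvolutionFamily V)
    (hstab : SplittingStable U V) : ∃ M ω : ℝ, 1 ≤ M ∧ ∀ (t : ℝ≥0) (n : ℕ), 1 ≤ n →
      ‖splittingOperator hU hV (t / n) ^ n‖ ≤ M * Real.exp (ω * t) := by
  obtain ⟨M, ω, hM, h⟩ := hstab
  refine ⟨M, ω, hM, fun t n hn =>
    ContinuousLinearMap.opNorm_le_bound _ (by positivity) fun f => ?_⟩
  rw [c0_norm_le (by positivity)]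
  intro s
  rw [splittingOperator_pow_apply]
  refine (ContinuousLinearMap.le_of_opNorm_le _ ?_ _).trans
    (mul_le_mul_of_nonneg_left (c0_norm_coe_le f _) (by positivity))
  simpa only [NNReal.coe_div, NNReal.coe_natCast, mul_div_assoc] using h t t.coe_nonneg n hn s

/-- Consistency of the splitting. With `T_U`, `T_V` the evolution operators and `R` the translation,
all at `h`, `F f - f = T_V R (T_U f - f) + T_V (R f - f) + (T_V f - f)`. After division by `h` the
terms tend to `-f' + a`, `f'` and `-f' + b`. -/
theorem negDerivAddAddGraph_subset_rightDerivGraph {A B : ℝ → X →ₗ.[𝕜] X}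
    (hU : IsEvolutionFamily U) (hV : IsEvolutionFamily V)
    (hGU : ClosureGenerates (negDerivAddGraph A) hU)
    (hGV : ClosureGenerates (negDerivAddGraph B) hV) :
    negDerivAddAddGraph A B ⊆ rightDerivGraph (splittingOperator hU hV) := by
  rintro ⟨f, g⟩ ⟨f', a, b, hf', ha, hb, rfl⟩
  have hA : Tendsto (fun h : ℝ≥0 => (h : ℝ)⁻¹ • (evolutionOperator hU h f - f)) (𝓝[>] 0)
      (𝓝 (-f' + a)) := by
    have h1 : (f, -f' + a) ∈ evolutionGeneratorGraph hU :=
      hGU ▸ subset_closure ⟨f', a, hf', ha, rfl⟩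
    exact h1
  have hB : Tendsto (fun h : ℝ≥0 => (h : ℝ)⁻¹ • (evolutionOperator hV h f - f)) (𝓝[>] 0)
      (𝓝 (-f' + b)) := by
    have h1 : (f, -f' + b) ∈ evolutionGeneratorGraph hV :=
      hGV ▸ subset_closure ⟨f', b, hf', hb, rfl⟩
    exact h1
  have hD : Tendsto (fun h : ℝ≥0 => (h : ℝ)⁻¹ • (translation h f - f)) (𝓝[>] 0) (𝓝 f') :=
    derivGraph_subset_rightDerivGraph_translation hf'
  obtain ⟨C, hC⟩ := eventually_norm_evolutionOperator_le hV
  have hC' := hC.filter_mono (nhdsWithin_le_nhds (s := Ioi 0))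
  have hV0 := fun y => (tendsto_evolutionOperator_zero hV y).mono_left
    (nhdsWithin_le_nhds (s := Ioi 0))
  have h1 := tendsto_apply_of_bounded hC' (hV0 (-f' + a)) (tendsto_apply_of_bounded
    (Eventually.of_forall fun h : ℝ≥0 => norm_translation_le h) (tendsto_translation (-f' + a)) hA)
  have h2 := tendsto_apply_of_bounded hC' (hV0 f') hD
  have h3 := (h1.add h2).add hB
  have e : -f' + a + f' + (-f' + b) = -f' + a + b := by abel
  rw [e] at h3
  refine h3.congr fun h => ?_
  simp only [splittingOperator, mul_apply_eq_comp, map_smul, map_sub, smul_sub]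
  abel

end Evolution

end NonautonomousSplitting

/-! ### Evaluation of the limit at a point. -/

open NonautonomousSplitting in
theorem mainTheorem2 {𝕜 X : Type*} [RCLike 𝕜] [NormedAddCommGroup X] [NormedSpace 𝕜 X]
    [NormedSpace ℝ X] [IsScalarTower ℝ 𝕜 X] [CompleteSpace X]
    (A B : ℝ → X →ₗ.[𝕜] X) (U V W : ℝ → ℝ → X →L[𝕜] X)
    (hA : WellPosed A) (hB : WellPosed B) (hAB : WellPosed (fun t => A t + B t))
    (hU : IsSolvingFamily A U) (hV : IsSolvingFamily B V)
    (hW : IsSolvingFamily (fun t => A t + B t) W)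
    (hGU : ClosureGenerates (negDerivAddGraph A) hU.toIsEvolutionFamily)
    (hGV : ClosureGenerates (negDerivAddGraph B) hV.toIsEvolutionFamily)
    (hGW : ClosureGenerates (negDerivAddAddGraph A B) hW.toIsEvolutionFamily)
    (hstab : SplittingStable U V) :
    ∀ s t : ℝ, s ≤ t → ∀ x : X,
      Filter.Tendsto
        (fun n : ℕ => timeOrderedProd
          (fun p => V (s + (p + 1) * (t - s) / n) (s + p * (t - s) / n) ∘L
            U (s + (p + 1) * (t - s) / n) (s + p * (t - s) / n)) n x)
        Filter.atTop (nhds (W t s x)) := by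
  have hU' := hU.toIsEvolutionFamily
  have hV' := hV.toIsEvolutionFamily
  have hW' := hW.toIsEvolutionFamily
  intro s t hst x
  -- Chernoff's formula is available for positive times only; at `t = s` every factor is the
  -- identity.
  rcases hst.eq_or_lt with rfl | hlt
  · have hprod : ∀ n : ℕ, timeOrderedProd
          (fun p => V (s + (p + 1) * (s - s) / n) (s + p * (s - s) / n) ∘L
            U (s + (p + 1) * (s - s) / n) (s + p * (s - s) / n)) n = 1 := by
      intro n
      refine List.prod_eq_one fun L hL => ?_
      simp only [List.mem_reverse, List.mem_map] at hL
      obtain ⟨p, -, rfl⟩ := hL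
      simp [hU'.diag, hV'.diag]
      rfl
    simp only [hprod, hW'.diag]
    exact tendsto_const_nhds
  · obtain ⟨f, rfl⟩ := exists_c0_apply_eq s x
    obtain ⟨M, ω, hM, hpow⟩ := norm_splittingOperator_pow_le hU' hV' hstab
    set τ : ℝ≥0 := (t - s).toNNReal
    have hτ : (τ : ℝ) = t - s := Real.coe_toNNReal _ (by linarith)
    have hτ0 : 0 < τ := Real.toNNReal_pos.2 (by linarith)
    have hlim := (isStronglyContinuousSemigroup_evolutionOperator hW').tendsto_pow_div
      (D := negDerivAddAddGraph A B) (by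
        -- The generator graph of the evolution semigroup is by definition the `rightDerivGraph` of
        -- its operators, so `hGW` says that the splitting domain is a core.
        rw [hGW]
        exact Set.Subset.rfl)
      (negDerivAddAddGraph_subset_rightDerivGraph hU' hV' hGU hGV) hM hpow hτ0 f
    have hpt := (ZeroAtInftyContinuousMap.tendsto_iff_tendstoUniformly.1 hlim).tendsto_at t
    rw [evolutionOperator_apply, hτ, sub_sub_cancel] at hpt
    refine hpt.congr' ?_
    filter_upwards [Filter.eventually_gt_atTop 0] with n hn
    have hn' : (n : ℝ) ≠ 0 := by exact_mod_cast hn.ne'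
    rw [splittingOperator_pow_apply, NNReal.coe_div, hτ, NNReal.coe_natCast,
      mul_div_cancel₀ _ hn', sub_sub_cancel]
    -- Powers of the splitting operator run backwards from `t`, the theorem forwards from `s`:
    -- factor `p` of one product is factor `n - 1 - p` of the other.
    rw [timeOrderedProd_eq_reverseTimeOrderedProd _ _ n fun p hp => ?_]
    have e1 : t - ((n - 1 - p : ℕ) : ℝ) * ((t - s) / n) = s + (p + 1) * (t - s) / n := by
      rw [Nat.sub_sub, Nat.cast_sub (by omega)]
      push_cast
      field_simp
      ring
    have e2 : t - (((n - 1 - p : ℕ) : ℝ) + 1) * ((t - s) / n) = s + p * (t - s) / n := by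
      rw [Nat.sub_sub, Nat.cast_sub (by omega)]
      push_cast
      field_simp
      ring
    rw [e1, e2]
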